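/- Let $n\in\mathbb{N}$, $n>2$, let $p_S=\frac{n+2}{n-2}$ be the critical Sobolev exponent, and let $$U(x)=\left(\frac{n(n-2)}{n(n-2)+|x|^2}\right)^{\frac{n-2}{2}},\qquad x\in\mathbb{R}^n,$$ be the Aubin–Talenti bubble, a positive radial solution of $-\Delta U=U^{p_S}$ in $\mathbb{R}^n$ with $U(0)=1$. For $v$ in the (real) Sobolev space $H^1(\mathbb{R}^n)$ let $$\mathcal{R}(v)=\int_{\mathbb{R}^n}\left(|\nabla v|^2-p_S|U|^{p_S-1}v^2\right)dx$$ be the Rayleigh functional associated with the linearized operator $L^*=-\Delta-p_S|U|^{p_S-1}$ on $\mathbb{R}^n$, and let $$\lambda_1^*=\inf\left\{\mathcal{R}(v)\;:\;v\in H^1(\mathbb{R}^n),\ \|v\|_{L^2(\mathbb{R}^n)}=1\right\}.$$ Then: (i) $-\infty<\lambda_1^*<0$; (ii) every minimizing sequence, that is, every sequence $(w_k)_{k\in\mathbb{N}}$ in $H^1(\mathbb{R}^n)$ with $\|w_k\|_{L^2(\mathbb{R}^n)}=1$ for all $k$ and $\mathcal{R}(w_k)\to\lambda_1^*$ as $k\to\infty$,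 has a subsequence which converges strongly in $L^2(\mathbb{R}^n)$. -/

import Mathlib

open MeasureTheory Filter Topology
open scoped ContDiff Gradient

namespace BubbleSpectral

/-- `ℝⁿ` with its Euclidean norm. -/
abbrev Rn (n : ℕ) : Type := EuclideanSpace ℝ (Fin n)

/-- The real Hilbert space `L²(ℝⁿ)`. -/
abbrev L2 (n : ℕ) : Type := Lp ℝ 2 (volume : Measure (Rn n))

/-- The Hilbert space `L²(ℝⁿ; ℝⁿ)` of square integrable vector fields. -/
abbrev L2Field (n : ℕ) : Type := Lp (Rn n) 2 (volume : Measure (Rn n))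

/-- `G` is the weak gradient of `v`: for every test function `φ ∈ C_c^∞(ℝⁿ)`,
`∫ v ∇φ dx = - ∫ φ G dx` (an identity between vectors of `ℝⁿ`). -/
def IsWeakGradient {n : ℕ} (v : L2 n) (G : L2Field n) : Prop :=
  ∀ φ : Rn n → ℝ, ContDiff ℝ ∞ φ → HasCompactSupport φ →
    ∫ x, v x • ∇ φ x = - ∫ x, φ x • G x

/-- The weak gradient is unique. -/
theorem IsWeakGradient.unique {n : ℕ} {v : L2 n} {G G' : L2Field n}
    (h : IsWeakGradient v G) (h' : IsWeakGradient v G') : G = G' := by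
  refine Lp.ext (ae_eq_of_integral_contDiff_smul_eq
    ((Lp.memLp G).locallyIntegrable (by norm_num))
    ((Lp.memLp G').locallyIntegrable (by norm_num)) fun φ hφ hc => ?_)
  exact neg_injective ((h φ hφ hc).symm.trans (h' φ hφ hc))

/-- The Sobolev space `H¹(ℝⁿ)`: the `v ∈ L²(ℝⁿ)` with a weak gradient in `L²`. -/
def H1 (n : ℕ) : Set (L2 n) := {v | ∃ G : L2Field n, IsWeakGradient v G}

open Classical in
/-- The weak gradient `∇v` of `v ∈ H¹(ℝⁿ)` (and, by convention, `0` for other `v`). -/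
noncomputable def weakGrad {n : ℕ} (v : L2 n) : L2Field n :=
  if h : v ∈ H1 n then h.choose else 0

theorem isWeakGradient_weakGrad {n : ℕ} {v : L2 n} (h : v ∈ H1 n) :
    IsWeakGradient v (weakGrad v) := by
  rw [weakGrad, dif_pos h]
  exact h.choose_spec

/-- The critical Sobolev exponent `p_S = (n + 2) / (n - 2)`. -/
noncomputable def pS (n : ℕ) : ℝ := ((n : ℝ) + 2) / ((n : ℝ) - 2)

/-- The Aubin–Talenti bubble
`U(x) = (n(n-2) / (n(n-2) + |x|²)) ^ ((n-2)/2)`. -/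
noncomputable def bubble (n : ℕ) (x : Rn n) : ℝ :=
  ((n : ℝ) * ((n : ℝ) - 2) / ((n : ℝ) * ((n : ℝ) - 2) + ‖x‖ ^ 2)) ^ (((n : ℝ) - 2) / 2)

/-- The Rayleigh functional of `L^* = -Δ - p_S |U|^{p_S - 1}`,
`R(v) = ∫ |∇v|² - p_S |U|^{p_S - 1} v² dx` for `v ∈ H¹(ℝⁿ)`. -/
noncomputable def rayleigh {n : ℕ} (v : L2 n) : ℝ :=
  ∫ x, (‖weakGrad v x‖ ^ 2 - pS n * |bubble n x| ^ (pS n - 1) * v x ^ 2)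

/-- The admissible functions `v ∈ H¹(ℝⁿ)` with `‖v‖_{L²(ℝⁿ)} = 1`. -/
def admissible (n : ℕ) : Set (L2 n) := {v | v ∈ H1 n ∧ ‖v‖ = 1}

/-- `λ₁^* = inf {R(v) : v ∈ H¹(ℝⁿ), ‖v‖_{L²(ℝⁿ)} = 1}`. -/
noncomputable def lambdaStar (n : ℕ) : ℝ := sInf (rayleigh '' admissible n)

/-- A minimizing sequence for `λ₁^*`. -/
def IsMinimizingSeq {n : ℕ} (w : ℕ → L2 n) : Prop :=
  (∀ k, w k ∈ admissible n) ∧ Tendsto (fun k => rayleigh (w k)) atTop (𝓝 (lambdaStar n))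

end BubbleSpectral

open BubbleSpectral

namespace BubbleSpectral

variable {n : ℕ}

/-! Write `a = n(n-2)` and `V = p_S |U|^{p_S-1} = p_S (a/(a+|x|²))²`, a bounded potential vanishing
at infinity. Boundedness of `V` gives `λ₁^* > -∞`. Negativity follows by testing with
`(a+|x|²)^{-n/2}`, whose energies are compared through a divergence identity
(`integral_norm_sq_eq`).

Compactness needs no existence of a minimizer. The form `Q(v) = R(v) - λ₁^*‖v‖²` is nonnegative on
`H¹`, so the parallelogram law gives `Q(v-w) ≤ 2Q(v) + 2Q(w)` (`rayleigh_sub_le`), and `Q` of the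
differences of a minimizing sequence tends to zero. Along a subsequence `∫ V (w_i - w_j)²` also
tends to zero (`exists_subseq_potForm_sub_le`): the tail of `V` is small, and on balls Rellich
compactness applies, proved here by replacing functions with their averages over small balls. What
remains in `Q` is `‖∇(w_i - w_j)‖² + |λ₁^*| ‖w_i - w_j‖²`; since `λ₁^* < 0`, the subsequence is
Cauchy in `L²`. -/

/-! ### Linearity of the weak gradient -/

theorem continuous_gradient_of_contDiff {φ : Rn n → ℝ} (hφ : ContDiff ℝ ∞ φ) :
    Continuous fun x => ∇ φ x :=
  (InnerProductSpace.toDual ℝ (Rn n)).symm.continuous.comp (hφ.continuous_fderiv (by simp))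

theorem hasCompactSupport_gradient {φ : Rn n → ℝ} (hc : HasCompactSupport φ) :
    HasCompactSupport fun x => ∇ φ x :=
  (hc.fderiv ℝ).comp_left (g := (InnerProductSpace.toDual ℝ (Rn n)).symm) (map_zero _)

theorem integrable_smul_gradient (v : L2 n) {φ : Rn n → ℝ} (hφ : ContDiff ℝ ∞ φ)
    (hc : HasCompactSupport φ) : Integrable fun x => v x • ∇ φ x :=
  ((Lp.memLp v).locallyIntegrable (by norm_num)).integrable_smul_right_of_hasCompactSupport
    (continuous_gradient_of_contDiff hφ) (hasCompactSupport_gradient hc)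

theorem integrable_smul_field (G : L2Field n) {φ : Rn n → ℝ} (hφ : ContDiff ℝ ∞ φ)
    (hc : HasCompactSupport φ) : Integrable fun x => φ x • G x :=
  ((Lp.memLp G).locallyIntegrable (by norm_num)).integrable_smul_left_of_hasCompactSupport
    hφ.continuous hc

theorem IsWeakGradient.add {v w : L2 n} {G H : L2Field n} (hv : IsWeakGradient v G)
    (hw : IsWeakGradient w H) : IsWeakGradient (v + w) (G + H) := by
  intro φ hφ hc
  have e₁ : ∫ x, (v + w : L2 n) x • ∇ φ x = ∫ x, (v x • ∇ φ x + w x • ∇ φ x) := by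
    refine integral_congr_ae ?_
    filter_upwards [Lp.coeFn_add v w] with x hx
    rw [hx, Pi.add_apply, add_smul]
  have e₂ : ∫ x, φ x • (G + H : L2Field n) x = ∫ x, (φ x • G x + φ x • H x) := by
    refine integral_congr_ae ?_
    filter_upwards [Lp.coeFn_add G H] with x hx
    rw [hx, Pi.add_apply, smul_add]
  rw [e₁, e₂, integral_add (integrable_smul_gradient v hφ hc) (integrable_smul_gradient w hφ hc),
    integral_add (integrable_smul_field G hφ hc) (integrable_smul_field H hφ hc), hv φ hφ hc,
    hw φ hφ hc, neg_add]

theorem IsWeakGradient.const_smul {v : L2 n} {G : L2Field n} (hv : IsWeakGradient v G) (c : ℝ) :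
    IsWeakGradient (c • v) (c • G) := by
  intro φ hφ hc
  have e₁ : ∫ x, (c • v : L2 n) x • ∇ φ x = ∫ x, c • (v x • ∇ φ x) := by
    refine integral_congr_ae ?_
    filter_upwards [Lp.coeFn_smul c v] with x hx
    rw [hx, Pi.smul_apply, smul_assoc]
  have e₂ : ∫ x, φ x • (c • G : L2Field n) x = ∫ x, c • (φ x • G x) := by
    refine integral_congr_ae ?_
    filter_upwards [Lp.coeFn_smul c G] with x hx
    rw [hx, Pi.smul_apply, smul_comm]
  rw [e₁, e₂, integral_smul, integral_smul, hv φ hφ hc, smul_neg]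

theorem IsWeakGradient.sub {v w : L2 n} {G H : L2Field n} (hv : IsWeakGradient v G)
    (hw : IsWeakGradient w H) : IsWeakGradient (v - w) (G - H) := by
  have := hv.add (hw.const_smul (-1))
  simpa [sub_eq_add_neg] using this

theorem IsWeakGradient.weakGrad_eq {v : L2 n} {G : L2Field n} (h : IsWeakGradient v G) :
    weakGrad v = G :=
  (isWeakGradient_weakGrad ⟨G, h⟩).unique h

/-! ### The potential -/

/-- The potential `V = p_S |U|^{p_S - 1}` of the linearized operator. -/
noncomputable def potential (n : ℕ) (x : Rn n) : ℝ := pS n * |bubble n x| ^ (pS n - 1)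

/-- The scale `n (n - 2)` of the bubble. -/
noncomputable def scale (n : ℕ) : ℝ := (n : ℝ) * ((n : ℝ) - 2)

theorem scale_pos (hn : 2 < n) : 0 < scale n := by
  have : (2 : ℝ) < n := by exact_mod_cast hn
  unfold scale
  exact mul_pos (by linarith) (by linarith)

theorem pS_pos (hn : 2 < n) : 0 < pS n := by
  have : (2 : ℝ) < n := by exact_mod_cast hn
  unfold pS
  exact div_pos (by linarith) (by linarith)

/-- Since `p_S - 1 = 4/(n-2)`, the exponents cancel to `2` in every dimension and `V` is rational in
`|x|²`. -/
theorem potential_eq (hn : 2 < n) (x : Rn n) :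
    potential n x = pS n * (scale n / (scale n + ‖x‖ ^ 2)) ^ 2 := by
  have h2 : (2 : ℝ) < n := by exact_mod_cast hn
  have ha := scale_pos hn
  have hq : 0 ≤ scale n / (scale n + ‖x‖ ^ 2) := by positivity
  have hb : bubble n x = (scale n / (scale n + ‖x‖ ^ 2)) ^ (((n : ℝ) - 2) / 2) := rfl
  have he : ((n : ℝ) - 2) / 2 * (pS n - 1) = 2 := by
    unfold pS
    have : (n : ℝ) - 2 ≠ 0 := by linarith
    field_simp
    ring
  rw [potential, hb, abs_of_nonneg (Real.rpow_nonneg hq _), ← Real.rpow_mul hq, he]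
  norm_cast

theorem potential_nonneg (hn : 2 < n) (x : Rn n) : 0 ≤ potential n x := by
  rw [potential_eq hn]
  have := pS_pos hn
  positivity

theorem potential_le (hn : 2 < n) (x : Rn n) : potential n x ≤ pS n := by
  rw [potential_eq hn]
  have ha := scale_pos hn
  have h1 : scale n / (scale n + ‖x‖ ^ 2) ≤ 1 :=
    div_le_one_of_le₀ (by nlinarith [sq_nonneg ‖x‖]) (by positivity)
  exact mul_le_of_le_one_right (pS_pos hn).le (pow_le_one₀ (by positivity) h1)

theorem continuous_potential (hn : 2 < n) : Continuous (potential n) := by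
  have ha := scale_pos hn
  rw [funext (potential_eq hn)]
  exact continuous_const.mul ((continuous_const.div (by fun_prop)
    fun x => by positivity).pow 2)

/-! ### The Rayleigh functional as a quadratic form -/

/-- The potential energy `∫ V v²`. -/
noncomputable def potForm (v : L2 n) : ℝ := ∫ x, potential n x * v x ^ 2

theorem integral_sq_eq_norm_sq (v : L2 n) : ∫ x, v x ^ 2 = ‖v‖ ^ 2 := by
  rw [← real_inner_self_eq_norm_sq, L2.inner_def]
  simp [pow_two]

theorem integral_norm_sq_eq_norm_sq (G : L2Field n) : ∫ x, ‖G x‖ ^ 2 = ‖G‖ ^ 2 := by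
  rw [← real_inner_self_eq_norm_sq, L2.inner_def]
  simp

theorem integrable_norm_sq (G : L2Field n) : Integrable fun x => ‖G x‖ ^ 2 :=
  (memLp_two_iff_integrable_sq_norm (Lp.aestronglyMeasurable G)).1 (Lp.memLp G)

theorem integrable_potential_mul_sq (hn : 2 < n) (v : L2 n) :
    Integrable fun x => potential n x * v x ^ 2 :=
  (Lp.memLp v).integrable_sq.bdd_mul (continuous_potential hn).aestronglyMeasurable
    (c := pS n) (Eventually.of_forall fun x => by
      rw [Real.norm_of_nonneg (potential_nonneg hn x)]; exact potential_le hn x)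

theorem potForm_le (hn : 2 < n) (v : L2 n) : potForm v ≤ pS n * ‖v‖ ^ 2 := by
  rw [← integral_sq_eq_norm_sq, ← integral_const_mul]
  exact integral_mono (integrable_potential_mul_sq hn v)
    ((Lp.memLp v).integrable_sq.const_mul _) fun x =>
      mul_le_mul_of_nonneg_right (potential_le hn x) (sq_nonneg _)

theorem potForm_smul (c : ℝ) (v : L2 n) : potForm (c • v) = c ^ 2 * potForm v := by
  rw [potForm, potForm, ← integral_const_mul]
  refine integral_congr_ae ?_
  filter_upwards [Lp.coeFn_smul c v] with x hx
  rw [hx, Pi.smul_apply, smul_eq_mul]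
  ring

theorem potForm_parallelogram (hn : 2 < n) (v w : L2 n) :
    potForm (v + w) + potForm (v - w) = 2 * potForm v + 2 * potForm w := by
  have hv := integrable_potential_mul_sq hn v
  have hw := integrable_potential_mul_sq hn w
  simp only [potForm]
  rw [← integral_add (integrable_potential_mul_sq hn _) (integrable_potential_mul_sq hn _),
    ← integral_const_mul, ← integral_const_mul,
    ← integral_add (hv.const_mul 2) (hw.const_mul 2)]
  refine integral_congr_ae ?_
  filter_upwards [Lp.coeFn_add v w, Lp.coeFn_sub v w] with x hx hy
  rw [hx, hy, Pi.add_apply, Pi.sub_apply]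
  ring

theorem rayleigh_eq (hn : 2 < n) (v : L2 n) : rayleigh v = ‖weakGrad v‖ ^ 2 - potForm v := by
  rw [← integral_norm_sq_eq_norm_sq, potForm,
    ← integral_sub (integrable_norm_sq _) (integrable_potential_mul_sq hn v)]
  rfl

theorem IsWeakGradient.rayleigh_eq (hn : 2 < n) {v : L2 n} {G : L2Field n}
    (h : IsWeakGradient v G) : rayleigh v = ‖G‖ ^ 2 - potForm v := by
  rw [BubbleSpectral.rayleigh_eq hn, h.weakGrad_eq]

theorem neg_pS_le_rayleigh (hn : 2 < n) {v : L2 n} (hv : ‖v‖ = 1) : -pS n ≤ rayleigh v := by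
  have := potForm_le hn v
  rw [rayleigh_eq hn]
  rw [hv] at this
  nlinarith [sq_nonneg ‖weakGrad v‖]

theorem rayleigh_smul (hn : 2 < n) {v : L2 n} (hv : v ∈ H1 n) (c : ℝ) :
    rayleigh (c • v) = c ^ 2 * rayleigh v := by
  have h := isWeakGradient_weakGrad hv
  rw [(h.const_smul c).rayleigh_eq hn, h.rayleigh_eq hn, potForm_smul, norm_smul, mul_pow,
    Real.norm_eq_abs, sq_abs]
  ring

theorem bddBelow_rayleigh (hn : 2 < n) : BddBelow (rayleigh '' admissible n) :=
  ⟨-pS n, by rintro _ ⟨v, hv, rfl⟩; exact neg_pS_le_rayleigh hn hv.2⟩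

/-- Homogeneity of degree two removes the normalization, making `R - λ₁^*‖·‖²` a nonnegative form on
all of `H¹`. -/
theorem lambdaStar_mul_le_rayleigh (hn : 2 < n) {v : L2 n} (hv : v ∈ H1 n) :
    lambdaStar n * ‖v‖ ^ 2 ≤ rayleigh v := by
  rcases eq_or_ne v 0 with rfl | h0
  · have := rayleigh_smul hn hv 0
    rw [zero_smul, zero_pow two_ne_zero, zero_mul] at this
    rw [this, norm_zero, zero_pow two_ne_zero, mul_zero]
  have hpos : 0 < ‖v‖ := norm_pos_iff.2 h0
  have hmem : ‖v‖⁻¹ • v ∈ admissible n :=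
    ⟨⟨_, (isWeakGradient_weakGrad hv).const_smul _⟩, by
      rw [norm_smul, norm_inv, norm_norm, inv_mul_cancel₀ hpos.ne']⟩
  have h := csInf_le (bddBelow_rayleigh hn) (Set.mem_image_of_mem rayleigh hmem)
  change lambdaStar n ≤ _ at h
  rw [rayleigh_smul hn hv] at h
  have h' := mul_le_mul_of_nonneg_right h (sq_nonneg ‖v‖)
  calc _ ≤ _ := h'
    _ = _ := by field_simp

theorem rayleigh_parallelogram (hn : 2 < n) {v w : L2 n} (hv : v ∈ H1 n) (hw : w ∈ H1 n) :
    rayleigh (v + w) + rayleigh (v - w) = 2 * rayleigh v + 2 * rayleigh w := by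
  have h := isWeakGradient_weakGrad hv
  have h' := isWeakGradient_weakGrad hw
  rw [(h.add h').rayleigh_eq hn, (h.sub h').rayleigh_eq hn, h.rayleigh_eq hn, h'.rayleigh_eq hn]
  have p₁ := potForm_parallelogram hn v w
  have p₂ := parallelogram_law_with_norm ℝ (weakGrad v) (weakGrad w)
  linarith

/-- Parallelogram law for `R - λ₁^*‖·‖²`, with the nonnegative term at `v + w` discarded. -/
theorem rayleigh_sub_le (hn : 2 < n) {v w : L2 n} (hv : v ∈ H1 n) (hw : w ∈ H1 n) :
    rayleigh (v - w) - lambdaStar n * ‖v - w‖ ^ 2 ≤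
      2 * (rayleigh v - lambdaStar n * ‖v‖ ^ 2) + 2 * (rayleigh w - lambdaStar n * ‖w‖ ^ 2) := by
  have h := rayleigh_parallelogram hn hv hw
  have h₁ := lambdaStar_mul_le_rayleigh hn (v := v + w)
    ⟨_, (isWeakGradient_weakGrad hv).add (isWeakGradient_weakGrad hw)⟩
  have h₂ := parallelogram_law_with_norm ℝ v w
  linear_combination h₁ + h - lambdaStar n * h₂

/-! ### Translations of `H¹` functions -/

/-- The translate `x ↦ v (x + z)`. -/
noncomputable def translate (z : Rn n) (v : L2 n) : L2 n :=
  Lp.compMeasurePreserving (fun x => x + z) (measurePreserving_add_right volume z) v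

theorem coeFn_translate (z : Rn n) (v : L2 n) : translate z v =ᵐ[volume] fun x => v (x + z) :=
  Lp.coeFn_compMeasurePreserving v (measurePreserving_add_right volume z)

/-- Testing against `C_c^∞` functions bounds the `L²` norm by duality. -/
theorem norm_le_of_inner_test_le {v : L2 n} {M : ℝ} (hM : 0 ≤ M)
    (h : ∀ φ : Rn n → ℝ, ContDiff ℝ ∞ φ → HasCompactSupport φ → ∀ f : L2 n, f =ᵐ[volume] φ →
      |inner ℝ v f| ≤ M * ‖f‖) : ‖v‖ ≤ M := by
  have hd : Dense {f : L2 n | ∃ g : Rn n → ℝ, f =ᵐ[volume] g ∧ HasCompactSupport g ∧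
      ContDiff ℝ ∞ g} := Lp.dense_hasCompactSupport_contDiff (by norm_num)
  have hc : IsClosed {f : L2 n | |inner ℝ v f| ≤ M * ‖f‖} :=
    isClosed_le (by fun_prop) (by fun_prop)
  -- The bound is a closed condition on `f`, so density allows `f = v`, whence `‖v‖² ≤ M‖v‖`.
  have hv : v ∈ {f : L2 n | |inner ℝ v f| ≤ M * ‖f‖} := by
    refine hc.closure_subset_iff.2 ?_ (hd v)
    rintro f ⟨g, hfg, hg, hg'⟩
    exact h g hg' hg f hfg
  simp only [Set.mem_ofPred_eq, real_inner_self_eq_norm_sq, abs_of_nonneg (sq_nonneg ‖v‖)] at hv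
  rcases (norm_nonneg v).eq_or_lt with h0 | h0
  · rwa [← h0]
  · nlinarith

theorem gradient_comp_sub_left {ψ : Rn n → ℝ} (hψ : Differentiable ℝ ψ) (z t : Rn n) :
    ∇ (fun s => ψ (z - s)) t = -∇ ψ (z - t) := by
  have h : HasFDerivAt (fun s => ψ (z - s)) (-(fderiv ℝ ψ (z - t))) t := by
    have := (hψ (z - t)).hasFDerivAt.comp t ((hasFDerivAt_id t).const_sub z)
    convert! this using 1
    ext; simp
  rw [gradient, gradient, h.fderiv, map_neg]

theorem norm_integral_smul_le (φ : L2 n) (G : L2Field n) :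
    ‖∫ x, φ x • G x‖ ≤ ‖φ‖ * ‖G‖ := by
  rw [Lp.norm_def, Lp.norm_def, ← ENNReal.toReal_mul]
  have h : eLpNorm (fun x => φ x • G x) 1 volume ≤ eLpNorm φ 2 volume * eLpNorm G 2 volume :=
    eLpNorm_smul_le_mul_eLpNorm (𝕜 := ℝ) (p := 2) (q := 2) (r := 1) (f := (G : Rn n → Rn n))
      (φ := (φ : Rn n → ℝ)) (Lp.aestronglyMeasurable G) (Lp.aestronglyMeasurable φ)
  rw [eLpNorm_one_eq_lintegral_enorm] at h
  refine (norm_integral_le_lintegral_norm _).trans ?_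
  simp only [ofReal_norm]
  exact ENNReal.toReal_mono (ENNReal.mul_ne_top (Lp.eLpNorm_ne_top φ) (Lp.eLpNorm_ne_top G)) h

/-- Translating a test function against `v` is Lipschitz in the translation. -/
theorem IsWeakGradient.abs_integral_translate_sub_le {v : L2 n} {G : L2Field n}
    (h : IsWeakGradient v G) {φ : Rn n → ℝ} (hφ : ContDiff ℝ ∞ φ) (hc : HasCompactSupport φ)
    {f : L2 n} (hf : f =ᵐ[volume] φ) (z : Rn n) :
    |(∫ t, v t * φ (t - z)) - ∫ t, v t * φ t| ≤ ‖G‖ * ‖f‖ * ‖z‖ := by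
  -- Reflecting `φ` turns the pairing into the convolution `(v * ψ)(z)`, to which the mean value
  -- inequality applies.
  let ψ : Rn n → ℝ := fun s => φ (-s)
  have hψ : ContDiff ℝ ∞ ψ := hφ.comp contDiff_neg
  have hψc : HasCompactSupport ψ := hc.comp_homeomorph (Homeomorph.neg (Rn n))
  let L := ContinuousLinearMap.mul ℝ ℝ
  have hd : ∀ y ∈ (Set.univ : Set (Rn n)), HasFDerivWithinAt
      (convolution (v : Rn n → ℝ) ψ L volume)
      (convolution (v : Rn n → ℝ) (fderiv ℝ ψ) (L.precompR (Rn n)) volume y) Set.univ y :=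
    fun y _ => (hψc.hasFDerivAt_convolution_right L ((Lp.memLp v).locallyIntegrable (by norm_num))
      (hψ.of_le (by simp)) y).hasFDerivWithinAt
  have hb : ∀ y ∈ (Set.univ : Set (Rn n)),
      ‖convolution (v : Rn n → ℝ) (fderiv ℝ ψ) (L.precompR (Rn n)) volume y‖ ≤ ‖G‖ * ‖f‖ := by
    intro y _
    -- Up to sign and Riesz duality the derivative at `y` is `∫ v ∇χ = -∫ χ G`; Cauchy–Schwarz
    -- bounds it, as `χ` is a translate of `φ` and has the norm of `f`.
    let χ : Rn n → ℝ := fun t => ψ (y - t)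
    have hχ : ContDiff ℝ ∞ χ := hψ.comp (by fun_prop)
    have hχc : HasCompactSupport χ := hψc.comp_homeomorph (Homeomorph.subLeft y)
    have hw := h χ hχ hχc
    have hm : MeasurePreserving (fun t : Rn n => t - y) volume volume :=
      measurePreserving_sub_right volume y
    let g : L2 n := Lp.compMeasurePreserving (fun t => t - y) hm f
    have hg : g =ᵐ[volume] χ := by
      refine (Lp.coeFn_compMeasurePreserving f hm).trans ?_
      filter_upwards [hm.quasiMeasurePreserving.ae_eq_comp hf] with t ht
      simpa [χ, ψ] using ht
    have hgn : ‖g‖ = ‖f‖ := Lp.norm_compMeasurePreserving f hm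
    have e₁ : ∫ t, χ t • G t = ∫ t, g t • G t :=
      integral_congr_ae (by filter_upwards [hg] with t ht; rw [ht])
    have hbound : ‖∫ t, v t • ∇ χ t‖ ≤ ‖G‖ * ‖f‖ := by
      rw [hw, norm_neg, e₁, ← hgn, mul_comm]
      exact norm_integral_smul_le g G
    have e₂ : convolution (v : Rn n → ℝ) (fderiv ℝ ψ) (L.precompR (Rn n)) volume y
        = ∫ t, v t • fderiv ℝ ψ (y - t) := by
      refine integral_congr_ae (Eventually.of_forall fun t => ?_)
      ext s
      simp [L, ContinuousLinearMap.precompR_apply]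
    have e₃ : ∫ t, v t • ∇ χ t = -(InnerProductSpace.toDual ℝ (Rn n)).symm
        (∫ t, v t • fderiv ℝ ψ (y - t)) := by
      refine Eq.trans ?_ (congrArg Neg.neg
        ((InnerProductSpace.toDual ℝ (Rn n)).symm.toContinuousLinearEquiv.integral_comp_comm
          (fun t => v t • fderiv ℝ ψ (y - t))))
      rw [← integral_neg]
      refine integral_congr_ae (Eventually.of_forall fun t => ?_)
      have := gradient_comp_sub_left (hψ.differentiable (by simp)) y t
      simp only [χ]
      rw [this, gradient, map_smul, smul_neg]
      rfl
    rw [e₂]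
    rwa [e₃, norm_neg, LinearIsometryEquiv.norm_map] at hbound
  have := convex_univ.norm_image_sub_le_of_norm_hasFDerivWithin_le hd hb (Set.mem_univ 0)
    (Set.mem_univ z)
  simpa [convolution, L, ψ, neg_sub] using this

/-- By duality and a change of variables the translation moves onto the test function. -/
theorem IsWeakGradient.norm_translate_sub_le {v : L2 n} {G : L2Field n}
    (h : IsWeakGradient v G) (z : Rn n) : ‖translate z v - v‖ ≤ ‖G‖ * ‖z‖ := by
  refine norm_le_of_inner_test_le (by positivity) fun φ hφ hc f hf => ?_
  have e₁ : inner ℝ (translate z v) f = ∫ t, v t * φ (t - z) := by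
    rw [L2.inner_def, ← integral_add_right_eq_self (fun t => v t * φ (t - z)) z]
    refine integral_congr_ae ?_
    filter_upwards [coeFn_translate z v, hf] with t ht ht'
    simp [ht, ht', mul_comm]
  have e₂ : inner ℝ v f = ∫ t, v t * φ t := by
    rw [L2.inner_def]
    refine integral_congr_ae ?_
    filter_upwards [hf] with t ht'
    simp [ht', mul_comm]
  rw [inner_sub_left, e₁, e₂]
  exact (h.abs_integral_translate_sub_le hφ hc hf z).trans_eq (by ring)

/-! ### Averages over small balls -/

/-- The average of `v` over the ball of radius `δ` around `x`. -/
noncomputable def ballAvg (δ : ℝ) (v : L2 n) (x : Rn n) : ℝ :=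
  ∫ y, v (x + y) ∂(ProbabilityTheory.cond volume (Metric.ball (0 : Rn n) δ))

theorem isProbabilityMeasure_cond_ball {δ : ℝ} (hδ : 0 < δ) :
    IsProbabilityMeasure (ProbabilityTheory.cond volume (Metric.ball (0 : Rn n) δ)) :=
  ProbabilityTheory.cond_isProbabilityMeasure_of_finite
    (Metric.measure_ball_pos volume 0 hδ).ne' measure_ball_lt_top.ne

/-- Being a pairing with a fixed `L²` function, an average passes to weak limits pointwise and is
controlled by Cauchy–Schwarz. -/
theorem ballAvg_eq_inner (δ : ℝ) (v : L2 n) (x : Rn n) :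
    ballAvg δ v x = (volume.real (Metric.ball (0 : Rn n) δ))⁻¹ *
      inner ℝ (indicatorConstLp 2 (measurableSet_ball (x := x) (ε := δ))
        (measure_ball_lt_top (μ := volume)).ne (1 : ℝ)) v := by
  rw [L2.inner_indicatorConstLp_one, ballAvg, ProbabilityTheory.cond, integral_smul_measure,
    smul_eq_mul, ENNReal.toReal_inv]
  congr 1
  rw [← integral_indicator measurableSet_ball, ← integral_indicator measurableSet_ball,
    ← integral_add_left_eq_self ((Metric.ball x δ).indicator (v : Rn n → ℝ)) x]
  refine integral_congr_ae (Eventually.of_forall fun y => ?_)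
  have : x + y ∈ Metric.ball x δ ↔ y ∈ Metric.ball (0 : Rn n) δ := by
    simp [Metric.mem_ball, dist_eq_norm]
  beta_reduce
  by_cases hy : y ∈ Metric.ball (0 : Rn n) δ
  · rw [Set.indicator_of_mem hy, Set.indicator_of_mem (this.2 hy)]
  · rw [Set.indicator_of_notMem hy, Set.indicator_of_notMem (mt this.1 hy)]

theorem ballAvg_sub (δ : ℝ) (v w : L2 n) (x : Rn n) :
    ballAvg δ (v - w) x = ballAvg δ v x - ballAvg δ w x := by
  simp only [ballAvg_eq_inner, inner_sub_right, mul_sub]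

/-- Ball averages are bounded by the `L²` norm, uniformly in the centre. -/
theorem exists_abs_ballAvg_le (n : ℕ) (δ : ℝ) :
    ∃ C : ℝ, 0 ≤ C ∧ ∀ (v : L2 n) (x : Rn n), |ballAvg δ v x| ≤ C * ‖v‖ := by
  refine ⟨(volume.real (Metric.ball (0 : Rn n) δ))⁻¹ *
    volume.real (Metric.ball (0 : Rn n) δ) ^ (1 / (2 : ℝ)), by positivity, fun v x => ?_⟩
  rw [ballAvg_eq_inner, abs_mul, abs_of_nonneg (by positivity), mul_assoc]
  refine mul_le_mul_of_nonneg_left ((abs_real_inner_le_norm _ _).trans_eq ?_) (by positivity)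
  rw [norm_indicatorConstLp (by norm_num) (by norm_num), norm_one, one_mul, Measure.real,
    Measure.addHaar_ball_center]
  simp [Measure.real]

theorem tendsto_ballAvg {δ : ℝ} {u : ℕ → L2 n} {w : L2 n}
    (h : ∀ e : L2 n, Tendsto (fun k => inner ℝ e (u k)) atTop (𝓝 (inner ℝ e w))) (x : Rn n) :
    Tendsto (fun k => ballAvg δ (u k) x) atTop (𝓝 (ballAvg δ w x)) := by
  simp only [ballAvg_eq_inner]
  exact (h _).const_mul _

theorem stronglyMeasurable_ballAvg {δ : ℝ} (hδ : 0 < δ) (v : L2 n) :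
    StronglyMeasurable (ballAvg δ v) := by
  have := isProbabilityMeasure_cond_ball (n := n) hδ
  have h : StronglyMeasurable fun p : Rn n × Rn n => v (p.1 + p.2) :=
    (Lp.stronglyMeasurable v).comp_measurable (by fun_prop)
  exact h.integral_prod_right

theorem integrable_add_left_cond_ball (δ : ℝ) (v : L2 n) (x : Rn n) :
    Integrable (fun y => v (x + y))
      (ProbabilityTheory.cond volume (Metric.ball (0 : Rn n) δ)) := by
  rcases le_or_gt δ 0 with h | h
  · simp [Metric.ball_eq_empty.2 h]
  have hm : MeasurePreserving (fun y : Rn n => x + y) volume volume :=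
    measurePreserving_add_left volume x
  have h1 : MemLp (fun y => v (x + y)) 2 (volume.restrict (Metric.ball (0 : Rn n) δ)) :=
    ((Lp.memLp v).comp_measurePreserving hm).restrict _
  have : IsFiniteMeasure (volume.restrict (Metric.ball (0 : Rn n) δ)) :=
    isFiniteMeasure_restrict.2 measure_ball_lt_top.ne
  exact (h1.integrable (by norm_num)).smul_measure
    (ENNReal.inv_ne_top.2 (Metric.measure_ball_pos volume 0 h).ne')

theorem eLpNorm_two_sq_eq_lintegral {α E : Type*} [MeasurableSpace α] [NormedAddCommGroup E]
    (f : α → E) (μ : Measure α) : eLpNorm f 2 μ ^ 2 = ∫⁻ x, ‖f x‖ₑ ^ 2 ∂μ := by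
  have := eLpNorm_nnreal_pow_eq_lintegral (f := f) (μ := μ) (p := 2) (by norm_num)
  norm_cast at this
  exact_mod_cast this

/-- A function of `H¹` is `L²`-close to its averages over small balls. -/
theorem IsWeakGradient.eLpNorm_sub_ballAvg_le {v : L2 n} {G : L2Field n}
    (h : IsWeakGradient v G) {δ : ℝ} (hδ : 0 < δ) :
    eLpNorm (fun x => v x - ballAvg δ v x) 2 volume ≤ ENNReal.ofReal (‖G‖ * δ) := by
  have hP := isProbabilityMeasure_cond_ball (n := n) hδ
  set P := ProbabilityTheory.cond volume (Metric.ball (0 : Rn n) δ) with hPdef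
  have hmeas : Measurable fun p : Rn n × Rn n => ‖v (p.1 + p.2) - v p.1‖ₑ ^ 2 := by
    have hv := (Lp.stronglyMeasurable v).measurable
    fun_prop
  -- Jensen for the uniform probability on the ball; Tonelli then reduces the claim to the
  -- translation estimate for `|y| < δ`.
  have jensen : ∀ x, ‖v x - ballAvg δ v x‖ₑ ^ 2 ≤ ∫⁻ y, ‖v (x + y) - v x‖ₑ ^ 2 ∂P := by
    intro x
    have e : v x - ballAvg δ v x = -∫ y, (v (x + y) - v x) ∂P := by
      rw [integral_sub (integrable_add_left_cond_ball δ v x) (integrable_const _), integral_const]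
      simp [ballAvg]
    have hm : AEStronglyMeasurable (fun y => v (x + y) - v x) P :=
      (integrable_add_left_cond_ball δ v x).aestronglyMeasurable.sub aestronglyMeasurable_const
    have h1 : ‖∫ y, (v (x + y) - v x) ∂P‖ₑ ≤ eLpNorm (fun y => v (x + y) - v x) 2 P := by
      refine (enorm_integral_le_lintegral_enorm _).trans ?_
      rw [← eLpNorm_one_eq_lintegral_enorm]
      exact eLpNorm_le_eLpNorm_of_exponent_le (by norm_num) hm
    rw [e, enorm_neg]
    refine (pow_le_pow_left' h1 2).trans_eq ?_
    exact eLpNorm_two_sq_eq_lintegral _ _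
  have trans : ∀ y ∈ Metric.ball (0 : Rn n) δ,
      ∫⁻ x, ‖v (x + y) - v x‖ₑ ^ 2 ≤ ENNReal.ofReal (‖G‖ * δ) ^ 2 := by
    intro y hy
    have e : eLpNorm (fun x => v (x + y) - v x) 2 volume = ‖translate y v - v‖ₑ := by
      rw [Lp.enorm_def]
      refine eLpNorm_congr_ae ?_
      filter_upwards [coeFn_translate y v, Lp.coeFn_sub (translate y v) v] with x hx hx'
      rw [hx', Pi.sub_apply, hx]
    rw [← eLpNorm_two_sq_eq_lintegral, e, ← ofReal_norm]
    refine pow_le_pow_left' (ENNReal.ofReal_le_ofReal ?_) 2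
    exact (h.norm_translate_sub_le y).trans
      (mul_le_mul_of_nonneg_left (mem_ball_zero_iff.1 hy).le (norm_nonneg G))
  have key : eLpNorm (fun x => v x - ballAvg δ v x) 2 volume ^ 2
      ≤ ENNReal.ofReal (‖G‖ * δ) ^ 2 := by
    calc _ = ∫⁻ x, ‖v x - ballAvg δ v x‖ₑ ^ 2 := eLpNorm_two_sq_eq_lintegral _ _
      _ ≤ ∫⁻ x, ∫⁻ y, ‖v (x + y) - v x‖ₑ ^ 2 ∂P := lintegral_mono jensen
      _ = ∫⁻ y, (∫⁻ x, ‖v (x + y) - v x‖ₑ ^ 2) ∂P := lintegral_lintegral_swap hmeas.aemeasurable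
      _ ≤ ∫⁻ _, ENNReal.ofReal (‖G‖ * δ) ^ 2 ∂P := by
        refine lintegral_mono_ae ?_
        filter_upwards [ProbabilityTheory.ae_cond_mem measurableSet_ball] with y hy
        exact trans y hy
      _ = _ := by simp
  exact (ENNReal.pow_le_pow_left_iff two_ne_zero).1 key

/-! ### Local compactness and the potential energy -/

/-- Bounded sequences in `L²(ℝⁿ)` have weakly convergent subsequences. -/
theorem exists_weakly_convergent_subseq {u : ℕ → L2 n} {C : ℝ} (hu : ∀ k, ‖u k‖ ≤ C) :
    ∃ k : ℕ → ℕ, StrictMono k ∧ ∃ w : L2 n, ∀ e : L2 n,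
      Tendsto (fun j => inner ℝ e (u (k j))) atTop (𝓝 (inner ℝ e w)) := by
  have hsep : TopologicalSpace.SeparableSpace (L2 n) := by
    have : Fact ((2 : ENNReal) ≠ ⊤) := ⟨by norm_num⟩
    have : SecondCountableTopology (L2 n) := inferInstance
    infer_instance
  -- Sequential Banach–Alaoglu, available by separability, transported by the Riesz isometry.
  have hK := WeakDual.isSeqCompact_closedBall ℝ (L2 n) 0 C
  let T : ℕ → WeakDual ℝ (L2 n) :=
    fun k => StrongDual.toWeakDual (InnerProductSpace.toDual ℝ (L2 n) (u k))
  have hT : ∀ k, T k ∈ WeakDual.toStrongDual ⁻¹' Metric.closedBall (0 : StrongDual ℝ (L2 n)) C := by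
    intro k
    rw [Set.mem_preimage, mem_closedBall_zero_iff]
    exact ((InnerProductSpace.toDual ℝ (L2 n)).norm_map (u k)).trans_le (hu k)
  obtain ⟨F, -, k, hk, hlim⟩ := hK hT
  refine ⟨k, hk, (InnerProductSpace.toDual ℝ (L2 n)).symm (WeakDual.toStrongDual F), fun e => ?_⟩
  have h := ((WeakDual.eval_continuous e).tendsto F).comp hlim
  have e₁ : inner ℝ e ((InnerProductSpace.toDual ℝ (L2 n)).symm (WeakDual.toStrongDual F)) = F e := by
    rw [real_inner_comm, InnerProductSpace.toDual_symm_apply]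
    rfl
  rw [e₁]
  refine h.congr fun j => ?_
  rw [real_inner_comm]
  exact InnerProductSpace.toDual_apply_apply

/-- Ball averages of a weakly convergent sequence converge in `L²` on sets of finite measure. -/
theorem tendsto_eLpNorm_ballAvg_sub {u : ℕ → L2 n} {w : L2 n} {C : ℝ} (hu : ∀ k, ‖u k‖ ≤ C)
    (h : ∀ e : L2 n, Tendsto (fun k => inner ℝ e (u k)) atTop (𝓝 (inner ℝ e w)))
    {δ : ℝ} (hδ : 0 < δ) {s : Set (Rn n)} (hs : volume s ≠ ⊤) :
    Tendsto (fun k => eLpNorm (fun x => ballAvg δ (u k) x - ballAvg δ w x) 2 (volume.restrict s))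
      atTop (𝓝 0) := by
  obtain ⟨A, hA, hAb⟩ := exists_abs_ballAvg_le n δ
  have hfin : IsFiniteMeasure (volume.restrict s) := isFiniteMeasure_restrict.2 hs
  have hbound : ∀ k x, ‖ballAvg δ (u k) x - ballAvg δ w x‖ₑ ^ 2
      ≤ ENNReal.ofReal (A * (C + ‖w‖)) ^ 2 := by
    intro k x
    rw [← ofReal_norm]
    refine pow_le_pow_left' (ENNReal.ofReal_le_ofReal ?_) 2
    rw [← ballAvg_sub, Real.norm_eq_abs]
    refine (hAb _ _).trans (mul_le_mul_of_nonneg_left ?_ hA)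
    exact (norm_sub_le _ _).trans (add_le_add_left (hu k) _)
  have hlim : Tendsto (fun k => ∫⁻ x in s, ‖ballAvg δ (u k) x - ballAvg δ w x‖ₑ ^ 2) atTop
      (𝓝 (∫⁻ _ in s, 0)) := by
    -- The averages converge pointwise and are uniformly bounded; constants are integrable because
    -- `s` has finite measure.
    refine tendsto_lintegral_of_dominated_convergence
      (fun _ => ENNReal.ofReal (A * (C + ‖w‖)) ^ 2) (fun k => ?_)
      (fun k => Eventually.of_forall (hbound k)) ?_ (Eventually.of_forall fun x => ?_)
    · exact (((stronglyMeasurable_ballAvg hδ _).sub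
        (stronglyMeasurable_ballAvg hδ _)).measurable.enorm).pow_const 2
    · rw [lintegral_const]
      exact ENNReal.mul_ne_top (ENNReal.pow_ne_top ENNReal.ofReal_ne_top) (measure_ne_top _ _)
    · have h1 : Tendsto (fun k => ballAvg δ (u k) x - ballAvg δ w x) atTop (𝓝 0) := by
        simpa using (tendsto_ballAvg (δ := δ) h x).sub_const (ballAvg δ w x)
      have h2 := ((continuous_enorm.tendsto (0 : ℝ)).comp h1)
      have h3 := ((ENNReal.continuous_pow 2).tendsto _).comp h2
      simpa [Function.comp_def] using h3
  rw [lintegral_zero] at hlim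
  simp only [← eLpNorm_two_sq_eq_lintegral] at hlim
  have h4 := ((ENNReal.continuous_rpow_const (y := (1 / 2 : ℝ))).tendsto _).comp hlim
  rw [ENNReal.zero_rpow_of_pos (by norm_num)] at h4
  refine h4.congr fun k => ?_
  rw [Function.comp_apply, ← ENNReal.rpow_natCast, ← ENNReal.rpow_mul]
  norm_num

/-- The potential energy splits into a part on a ball and a small tail. -/
theorem exists_potForm_le (hn : 2 < n) {ε : ℝ} (hε : 0 < ε) :
    ∃ R : ℝ, ∀ v : L2 n, potForm v ≤
      pS n * (eLpNorm v 2 (volume.restrict (Metric.ball (0 : Rn n) R))).toReal ^ 2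
        + ε * ‖v‖ ^ 2 := by
  have ha := scale_pos hn
  have hp := pS_pos hn
  obtain ⟨R, hR, hRε⟩ : ∃ R : ℝ, 0 < R ∧ ∀ x : Rn n, R ≤ ‖x‖ → potential n x ≤ ε := by
    have ht : Tendsto (fun r : ℝ => pS n * (scale n / (scale n + r ^ 2)) ^ 2) atTop (𝓝 0) := by
      have h1 : Tendsto (fun r : ℝ => scale n + r ^ 2) atTop atTop :=
        tendsto_atTop_add_const_left _ _ (tendsto_pow_atTop two_ne_zero)
      simpa using ((h1.const_div_atTop (scale n)).pow 2).const_mul (pS n)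
    obtain ⟨R, hR⟩ := eventually_atTop.1 ((ht.eventually (gt_mem_nhds hε)).and
      (eventually_gt_atTop 0))
    refine ⟨R, (hR R le_rfl).2, fun x hx => ?_⟩
    rw [potential_eq hn]
    exact (hR ‖x‖ hx).1.le
  refine ⟨R, fun v => ?_⟩
  have hsq := (Lp.memLp v).integrable_sq
  have e : (eLpNorm v 2 (volume.restrict (Metric.ball (0 : Rn n) R))).toReal ^ 2
      = ∫ x in Metric.ball (0 : Rn n) R, v x ^ 2 := by
    rw [← ENNReal.toReal_pow, eLpNorm_two_sq_eq_lintegral,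
      integral_eq_lintegral_of_nonneg_ae (Eventually.of_forall fun x => sq_nonneg _)
        hsq.restrict.aestronglyMeasurable]
    congr 1
    refine lintegral_congr fun x => ?_
    rw [← ofReal_norm, ← ENNReal.ofReal_pow (norm_nonneg _), Real.norm_eq_abs, sq_abs]
  rw [e, ← integral_sq_eq_norm_sq, ← integral_indicator measurableSet_ball, ← integral_const_mul,
    ← integral_const_mul, ← integral_add ((hsq.indicator measurableSet_ball).const_mul _)
      (hsq.const_mul _)]
  refine integral_mono (integrable_potential_mul_sq hn v)
    (((hsq.indicator measurableSet_ball).const_mul _).add (hsq.const_mul _)) fun x => ?_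
  have hx := sq_nonneg (v x)
  by_cases hxR : x ∈ Metric.ball (0 : Rn n) R
  · simp only [Set.indicator_of_mem hxR]
    nlinarith [mul_le_mul_of_nonneg_right (potential_le hn x) hx]
  · simp only [Set.indicator_of_notMem hxR]
    rw [mul_zero, zero_add]
    exact mul_le_mul_of_nonneg_right (hRε x (by simpa using hxR)) hx

/-- A sequence bounded in `H¹` has a subsequence along which the potential energies of differences
tend to zero. -/
theorem exists_subseq_potForm_sub_le (hn : 2 < n) {u : ℕ → L2 n} {G : ℕ → L2Field n} {C D : ℝ}
    (hG : ∀ k, IsWeakGradient (u k) (G k)) (hu : ∀ k, ‖u k‖ ≤ C) (hGb : ∀ k, ‖G k‖ ≤ D) :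
    ∃ k : ℕ → ℕ, StrictMono k ∧ ∀ ε > 0, ∃ N, ∀ i ≥ N, ∀ j ≥ N,
      potForm (u (k i) - u (k j)) ≤ ε := by
  obtain ⟨k, hk, w, hw⟩ := exists_weakly_convergent_subseq hu
  refine ⟨k, hk, fun ε hε => ?_⟩
  have hC : 0 ≤ C := (norm_nonneg _).trans (hu 0)
  have hD : 0 ≤ D := (norm_nonneg _).trans (hGb 0)
  have hp := pS_pos hn
  -- Differences satisfy `‖v‖² ≤ 4C²`, so the tail costs at most `ε/2`; the `+ 1` covers `C = 0`.
  obtain ⟨R, hR⟩ := exists_potForm_le hn (ε := ε / (2 * (4 * C ^ 2 + 1))) (by positivity)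
  obtain ⟨η, hη, hη'⟩ : ∃ η : ℝ, 0 < η ∧ pS n * (3 * η) ^ 2 ≤ ε / 2 := by
    refine ⟨Real.sqrt (ε / (18 * pS n)), by positivity, ?_⟩
    rw [mul_pow, Real.sq_sqrt (by positivity)]
    apply le_of_eq
    field_simp
    norm_num
  -- Gradients of differences have norm at most `2D`, so averaging at radius `δ` costs at most `η`.
  let δ := η / (2 * D + 1)
  have hδ : 0 < δ := by positivity
  have hloc := tendsto_eLpNorm_ballAvg_sub (fun j => hu (k j)) hw hδ
    (measure_ball_lt_top (μ := (volume : Measure (Rn n))) (x := 0) (r := R)).ne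
  obtain ⟨N, hN⟩ := eventually_atTop.1
    (hloc.eventually_le_const (ENNReal.ofReal_pos.2 hη))
  refine ⟨N, fun i hi j hj => (hR _).trans ?_⟩
  set v := u (k i) - u (k j) with hv
  set μ := volume.restrict (Metric.ball (0 : Rn n) R) with hμ
  have hvn : ‖v‖ ^ 2 ≤ 4 * C ^ 2 := by
    have : ‖v‖ ≤ 2 * C := (norm_sub_le _ _).trans (by linarith [hu (k i), hu (k j)])
    nlinarith [norm_nonneg v]
  have hloc' : eLpNorm v 2 μ ≤ ENNReal.ofReal (3 * η) := by
    let f₁ : Rn n → ℝ := fun x => v x - ballAvg δ v x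
    let f₂ : Rn n → ℝ := fun x => ballAvg δ (u (k i)) x - ballAvg δ w x
    let f₃ : Rn n → ℝ := fun x => ballAvg δ (u (k j)) x - ballAvg δ w x
    have hm : ∀ y : L2 n, AEStronglyMeasurable (ballAvg δ y) μ :=
      fun y => (stronglyMeasurable_ballAvg hδ y).aestronglyMeasurable
    have hm₁ : AEStronglyMeasurable f₁ μ :=
      (Lp.stronglyMeasurable v).aestronglyMeasurable.sub (hm v)
    have hm₂ : AEStronglyMeasurable f₂ μ := (hm _).sub (hm _)
    have hm₃ : AEStronglyMeasurable f₃ μ := (hm _).sub (hm _)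
    -- Averaging error plus the deviations of two averages from the average of the weak limit: three
    -- pieces of size `η`.
    have hsum : (v : Rn n → ℝ) = f₁ + (f₂ - f₃) := by
      funext x
      simp only [Pi.add_apply, Pi.sub_apply, f₁, f₂, f₃, hv, ballAvg_sub]
      ring
    have b₁ : eLpNorm f₁ 2 μ ≤ ENNReal.ofReal η := by
      refine (eLpNorm_mono_measure _ Measure.restrict_le_self).trans
        ((((hG (k i)).sub (hG (k j))).eLpNorm_sub_ballAvg_le hδ).trans
          (ENNReal.ofReal_le_ofReal ?_))
      have : ‖G (k i) - G (k j)‖ ≤ 2 * D + 1 :=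
        (norm_sub_le _ _).trans (by linarith [hGb (k i), hGb (k j)])
      refine (mul_le_mul_of_nonneg_right this hδ.le).trans_eq ?_
      exact mul_div_cancel₀ η (by positivity)
    rw [hsum]
    calc eLpNorm (f₁ + (f₂ - f₃)) 2 μ
        ≤ eLpNorm f₁ 2 μ + (eLpNorm f₂ 2 μ + eLpNorm f₃ 2 μ) :=
          (eLpNorm_add_le hm₁ (hm₂.sub hm₃) (by norm_num)).trans
            (add_le_add_right (eLpNorm_sub_le hm₂ hm₃ (by norm_num)) _)
      _ ≤ ENNReal.ofReal η + (ENNReal.ofReal η + ENNReal.ofReal η) :=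
          add_le_add b₁ (add_le_add (hN i hi) (hN j hj))
      _ = ENNReal.ofReal (3 * η) := by
          rw [← ENNReal.ofReal_add hη.le hη.le, ← ENNReal.ofReal_add hη.le (by positivity)]
          ring_nf
  have hreal : (eLpNorm v 2 μ).toReal ≤ 3 * η := ENNReal.toReal_le_of_le_ofReal (by positivity) hloc'
  have t₁ : pS n * (eLpNorm v 2 μ).toReal ^ 2 ≤ ε / 2 :=
    (mul_le_mul_of_nonneg_left (pow_le_pow_left₀ ENNReal.toReal_nonneg hreal 2) hp.le).trans hη'
  have t₂ : ε / (2 * (4 * C ^ 2 + 1)) * ‖v‖ ^ 2 ≤ ε / 2 := by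
    rw [div_mul_eq_mul_div, div_le_div_iff₀ (by positivity) (by positivity)]
    nlinarith
  linarith

/-! ### A test function with negative energy -/

/-- The classical gradient of a `C¹` function is its weak gradient. -/
theorem isWeakGradient_toLp {f : Rn n → ℝ} {F : Rn n → Rn n} (hf : MemLp f 2 volume)
    (hF : MemLp F 2 volume) (hd : ∀ x, HasGradientAt f (F x) x) :
    IsWeakGradient (hf.toLp f) (hF.toLp F) := by
  intro φ hφ hc
  have e₁ : ∫ x, hf.toLp f x • ∇ φ x = ∫ x, f x • ∇ φ x :=
    integral_congr_ae (by filter_upwards [hf.coeFn_toLp] with x hx; rw [hx])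
  have e₂ : ∫ x, φ x • hF.toLp F x = ∫ x, φ x • F x :=
    integral_congr_ae (by filter_upwards [hF.coeFn_toLp] with x hx; rw [hx])
  have i₁ : Integrable fun x => f x • ∇ φ x :=
    (integrable_smul_gradient (hf.toLp f) hφ hc).congr
      (by filter_upwards [hf.coeFn_toLp] with x hx; rw [hx])
  have i₂ : Integrable fun x => φ x • F x :=
    (integrable_smul_field (hF.toLp F) hφ hc).congr
      (by filter_upwards [hF.coeFn_toLp] with x hx; rw [hx])
  have i₃ : Integrable fun x => f x * φ x := by
    simpa using (hf.locallyIntegrable (by norm_num)).integrable_smul_right_of_hasCompactSupport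
      hφ.continuous hc
  have hfd : ∀ x h, fderiv ℝ f x h = inner ℝ h (F x) := fun x h => by
    rw [(hd x).hasFDerivAt.fderiv, InnerProductSpace.toDual_apply_apply, real_inner_comm]
  have hφd : ∀ x h, fderiv ℝ φ x h = inner ℝ h (∇ φ x) := fun x h => by
    rw [real_inner_comm, gradient, InnerProductSpace.toDual_symm_apply]
  rw [e₁, e₂]
  -- Pairing with a fixed direction reduces the vector identity to scalar integration by parts.
  refine ext_inner_left ℝ fun h => ?_
  rw [inner_neg_right, ← integral_inner i₁, ← integral_inner i₂]
  have := integral_mul_fderiv_eq_neg_fderiv_mul_of_integrable (μ := (volume : Measure (Rn n)))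
    (f := f) (g := φ) (v := h) ?_ ?_ i₃ (fun x _ => (hd x).hasFDerivAt.differentiableAt)
    (fun x _ => hφ.differentiable (by simp) x)
  · simp only [hfd, hφd] at this
    simp only [inner_smul_right, mul_comm (φ _)]
    exact this
  · simpa only [hfd, inner_smul_right, mul_comm (φ _)] using i₂.const_inner (𝕜 := ℝ) h
  · simpa only [hφd, inner_smul_right] using i₁.const_inner (𝕜 := ℝ) h

theorem one_le_scale (hn : 2 < n) : 1 ≤ scale n := by
  have : (3 : ℝ) ≤ n := by exact_mod_cast hn
  unfold scale
  nlinarith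

theorem integrable_scale_add_norm_sq_rpow (hn : 2 < n) {t : ℝ} (ht : (n : ℝ) < 2 * t) :
    Integrable fun x : Rn n => (scale n + ‖x‖ ^ 2) ^ (-t) := by
  have ha := one_le_scale hn
  have h := integrable_rpow_neg_one_add_norm_sq (E := Rn n) (μ := volume) (r := 2 * t)
    (by simpa using ht)
  refine h.mono' ?_ (Eventually.of_forall fun x => ?_)
  · exact (Continuous.rpow_const (by fun_prop) fun x => Or.inl (by positivity)).aestronglyMeasurable
  · have e : -(2 * t) / 2 = -t := by ring
    rw [Real.norm_of_nonneg (by positivity), e]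
    have : (0 : ℝ) ≤ n := Nat.cast_nonneg n
    exact Real.rpow_le_rpow_of_nonpos (by positivity) (by linarith) (by linarith)

theorem integrable_inv_scale_add_norm_sq_pow (hn : 2 < n) {k : ℕ} (hk : n < 2 * k) :
    Integrable fun x : Rn n => ((scale n + ‖x‖ ^ 2) ^ k)⁻¹ := by
  have h := integrable_scale_add_norm_sq_rpow hn (t := k) (by exact_mod_cast hk)
  have ha := scale_pos hn
  refine h.congr (Eventually.of_forall fun x => ?_)
  simp only
  rw [Real.rpow_neg (by positivity), Real.rpow_natCast]

theorem integrable_norm_sq_div (hn : 2 < n) :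
    Integrable fun x : Rn n => ‖x‖ ^ 2 * ((scale n + ‖x‖ ^ 2) ^ (n + 2))⁻¹ := by
  have ha := scale_pos hn
  refine (integrable_inv_scale_add_norm_sq_pow hn (k := n + 1) (by omega)).mono' ?_
    (Eventually.of_forall fun x => ?_)
  · exact (Continuous.mul (by fun_prop) (Continuous.inv₀ (by fun_prop)
      fun x => by positivity)).aestronglyMeasurable
  · rw [Real.norm_of_nonneg (by positivity), pow_succ (_ + _) (n + 1), mul_inv, ← mul_assoc,
      mul_comm (‖x‖ ^ 2), mul_assoc]
    refine mul_le_of_le_one_right (by positivity) ?_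
    rw [← div_eq_mul_inv]
    exact div_le_one_of_le₀ (by linarith) (by positivity)

/-- The integrand is the derivative of `r^n / (a+r²)^{n+1}`, which vanishes at `0` and at infinity.
-/
theorem integral_Ioi_radial {a : ℝ} (ha : 0 < a) (hn : 0 < n)
    (hint : IntegrableOn (fun r : ℝ => r ^ (n - 1) *
      ((n * a - (n + 2) * r ^ 2) * ((a + r ^ 2) ^ (n + 2))⁻¹)) (Set.Ioi 0)) :
    ∫ r in Set.Ioi (0 : ℝ), r ^ (n - 1) *
      ((n * a - (n + 2) * r ^ 2) * ((a + r ^ 2) ^ (n + 2))⁻¹) = 0 := by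
  obtain ⟨m, rfl⟩ : ∃ m, n = m + 1 := ⟨n - 1, by omega⟩
  have hderiv : ∀ r ∈ Set.Ici (0 : ℝ), HasDerivAt
      (fun r : ℝ => r ^ (m + 1) / (a + r ^ 2) ^ (m + 2)) (r ^ m *
      (((m + 1 : ℕ) * a - ((m + 1 : ℕ) + 2) * r ^ 2) * ((a + r ^ 2) ^ (m + 1 + 2))⁻¹)) r := by
    intro r _
    have hb : a + r ^ 2 ≠ 0 := by positivity
    have h1 := hasDerivAt_pow (m + 1) r
    have h2 := ((hasDerivAt_pow 2 r).const_add a).pow (m + 2)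
    convert! h1.div h2 (pow_ne_zero _ hb) using 1
    simp only [Nat.add_sub_cancel, Pi.pow_apply]
    push_cast
    field_simp
    ring
  have hlim : Tendsto (fun r : ℝ => r ^ (m + 1) / (a + r ^ 2) ^ (m + 2)) atTop (𝓝 0) := by
    refine squeeze_zero' (g := fun r : ℝ => r⁻¹) ?_ ?_ tendsto_inv_atTop_zero
    · filter_upwards [eventually_ge_atTop 0] with r hr
      positivity
    · filter_upwards [eventually_ge_atTop 1] with r hr
      have hr0 : 0 < r := by linarith
      rw [div_le_iff₀ (by positivity), ← div_eq_inv_mul, le_div_iff₀ hr0, ← pow_succ]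
      exact pow_le_pow_left₀ hr0.le (by nlinarith) _
  have := integral_Ioi_of_hasDerivAt_of_tendsto' hderiv hint hlim
  simpa using this

/-- The divergence identity for the field `x ↦ x (a + |x|²)^{-n-1}`. -/
theorem integral_norm_sq_eq (hn : 2 < n) :
    ((n : ℝ) + 2) * ∫ x : Rn n, ‖x‖ ^ 2 * ((scale n + ‖x‖ ^ 2) ^ (n + 2))⁻¹
      = n * scale n * ∫ x : Rn n, ((scale n + ‖x‖ ^ 2) ^ (n + 2))⁻¹ := by
  have i₁ := integrable_norm_sq_div hn
  have i₀ := integrable_inv_scale_add_norm_sq_pow hn (k := n + 2) (by omega)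
  -- The divergence of the field is `F ‖x‖`; its integral is computed in polar coordinates.
  let F : ℝ → ℝ := fun r => (n * scale n - (n + 2) * r ^ 2) * ((scale n + r ^ 2) ^ (n + 2))⁻¹
  have hF : (fun x : Rn n => F ‖x‖) = fun x : Rn n =>
      n * scale n * ((scale n + ‖x‖ ^ 2) ^ (n + 2))⁻¹
        - (n + 2) * (‖x‖ ^ 2 * ((scale n + ‖x‖ ^ 2) ^ (n + 2))⁻¹) := by
    funext x; simp only [F]; ring
  have hFi : Integrable fun x : Rn n => F ‖x‖ := by
    rw [hF]; exact (i₀.const_mul _).sub (i₁.const_mul _)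
  have : Nontrivial (Rn n) := by
    have : Nonempty (Fin n) := ⟨⟨0, by omega⟩⟩
    infer_instance
  have hFr := (integrable_fun_norm_addHaar volume (f := F)).1 hFi
  have h0 := integral_fun_norm_addHaar (volume : Measure (Rn n)) F
  simp only [finrank_euclideanSpace, Fintype.card_fin, smul_eq_mul] at hFr h0
  rw [integral_Ioi_radial (scale_pos hn) (by omega) hFr, mul_zero, smul_zero, hF,
    integral_sub (i₀.const_mul _) (i₁.const_mul _), integral_const_mul, integral_const_mul] at h0
  linarith

/-- The profile `(a + |x|²)^{-n/2}`. -/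
noncomputable def profile (n : ℕ) (x : Rn n) : ℝ := (scale n + ‖x‖ ^ 2) ^ (-(n : ℝ) / 2)

/-- The gradient `-n (a + |x|²)^{-n/2-1} x` of the profile. -/
noncomputable def profileGrad (n : ℕ) (x : Rn n) : Rn n :=
  (-(n : ℝ) * (scale n + ‖x‖ ^ 2) ^ (-(n : ℝ) / 2 - 1)) • x

theorem hasGradientAt_profile (hn : 2 < n) (x : Rn n) :
    HasGradientAt (profile n) (profileGrad n x) x := by
  have ha := scale_pos hn
  have h1 : HasFDerivAt (fun x : Rn n => scale n + ‖x‖ ^ 2) (2 • innerSL ℝ x) x :=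
    (hasStrictFDerivAt_norm_sq x).hasFDerivAt.const_add _
  have h2 := h1.rpow_const (p := -(n : ℝ) / 2) (Or.inl (by positivity))
  rw [hasGradientAt_iff_hasFDerivAt]
  convert! h2 using 1
  ext y
  simp [profileGrad]
  ring

theorem rpow_sq_eq_inv_pow {b s : ℝ} {k : ℕ} (hb : 0 < b) (h : s * 2 = -k) :
    (b ^ s) ^ 2 = (b ^ k)⁻¹ := by
  rw [← Real.rpow_mul_natCast hb.le, Nat.cast_ofNat, h, Real.rpow_neg hb.le, Real.rpow_natCast]

theorem profile_sq (hn : 2 < n) (x : Rn n) :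
    profile n x ^ 2 = ((scale n + ‖x‖ ^ 2) ^ n)⁻¹ := by
  have ha := scale_pos hn
  exact rpow_sq_eq_inv_pow (by positivity) (by ring)

theorem norm_profileGrad_sq (hn : 2 < n) (x : Rn n) :
    ‖profileGrad n x‖ ^ 2 = n ^ 2 * (‖x‖ ^ 2 * ((scale n + ‖x‖ ^ 2) ^ (n + 2))⁻¹) := by
  have ha := scale_pos hn
  have e : ((scale n + ‖x‖ ^ 2) ^ (-(n : ℝ) / 2 - 1)) ^ 2 = ((scale n + ‖x‖ ^ 2) ^ (n + 2))⁻¹ :=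
    rpow_sq_eq_inv_pow (by positivity) (by push_cast; ring)
  rw [profileGrad, norm_smul, mul_pow, Real.norm_eq_abs, sq_abs, mul_pow, e]
  ring

theorem continuous_profile (hn : 2 < n) : Continuous (profile n) := by
  have ha := scale_pos hn
  exact Continuous.rpow_const (by fun_prop) fun x => Or.inl (by positivity)

theorem continuous_profileGrad (hn : 2 < n) : Continuous (profileGrad n) := by
  have ha := scale_pos hn
  exact (continuous_const.mul (Continuous.rpow_const (by fun_prop)
    fun x => Or.inl (by positivity))).smul continuous_id

theorem memLp_profile (hn : 2 < n) : MemLp (profile n) 2 volume := by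
  rw [memLp_two_iff_integrable_sq (continuous_profile hn).aestronglyMeasurable]
  simp only [profile_sq hn]
  exact integrable_inv_scale_add_norm_sq_pow hn (by omega)

theorem memLp_profileGrad (hn : 2 < n) : MemLp (profileGrad n) 2 volume := by
  rw [memLp_two_iff_integrable_sq_norm (continuous_profileGrad hn).aestronglyMeasurable]
  simp only [norm_profileGrad_sq hn]
  exact (integrable_norm_sq_div hn).const_mul _

/-- The profile is a multiple of `U^{n/(n-2)}`; unlike `U` itself, which is not in `L²` for `n = 3,
4`, it is admissible in all dimensions. Eliminating `I₁` by the divergence identity gives `(n+2) R =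
-n a (4n+4) I₀`. -/
theorem exists_rayleigh_neg (hn : 2 < n) : ∃ v ∈ H1 n, rayleigh v < 0 := by
  have hw := isWeakGradient_toLp (memLp_profile hn) (memLp_profileGrad hn)
    (hasGradientAt_profile hn)
  refine ⟨_, ⟨_, hw⟩, ?_⟩
  have h2 : (2 : ℝ) < n := by exact_mod_cast hn
  have ha := scale_pos hn
  set I₀ := ∫ x : Rn n, ((scale n + ‖x‖ ^ 2) ^ (n + 2))⁻¹ with hI₀
  set I₁ := ∫ x : Rn n, ‖x‖ ^ 2 * ((scale n + ‖x‖ ^ 2) ^ (n + 2))⁻¹ with hI₁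
  have hg : ‖(memLp_profileGrad hn).toLp (profileGrad n)‖ ^ 2 = n ^ 2 * I₁ := by
    rw [← integral_norm_sq_eq_norm_sq, hI₁, ← integral_const_mul]
    refine integral_congr_ae ?_
    filter_upwards [(memLp_profileGrad hn).coeFn_toLp] with x hx
    rw [hx, norm_profileGrad_sq hn]
  have hp : potForm ((memLp_profile hn).toLp (profile n)) = n * (n + 2) * scale n * I₀ := by
    rw [potForm, hI₀, ← integral_const_mul]
    refine integral_congr_ae ?_
    filter_upwards [(memLp_profile hn).coeFn_toLp] with x hx
    have hb : scale n + ‖x‖ ^ 2 ≠ 0 := by positivity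
    have hc : (n : ℝ) - 2 ≠ 0 := by linarith
    have hpS : pS n * scale n = n * (n + 2) := by
      rw [pS, scale]; field_simp
    rw [hx, profile_sq hn, potential_eq hn, ← hpS, div_pow, pow_add]
    field_simp
  have hI : ((n : ℝ) + 2) * I₁ = n * scale n * I₀ := integral_norm_sq_eq hn
  have hpos : 0 < I₀ := by
    rw [hI₀, integral_pos_iff_support_of_nonneg (fun x => by positivity)
      (integrable_inv_scale_add_norm_sq_pow hn (by omega))]
    have : Function.support (fun x : Rn n => ((scale n + ‖x‖ ^ 2) ^ (n + 2))⁻¹) = Set.univ := by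
      ext x
      have : 0 < scale n + ‖x‖ ^ 2 := by positivity
      simp [this.ne']
    rw [this]
    exact Measure.measure_univ_pos.2 (NeZero.ne _)
  rw [hw.rayleigh_eq hn, hg, hp]
  have key : ((n : ℝ) + 2) * (n ^ 2 * I₁ - n * (n + 2) * scale n * I₀)
      = -(n * scale n * I₀ * (4 * n + 4)) := by
    linear_combination (n : ℝ) ^ 2 * hI
  have : 0 < (n : ℝ) * scale n * I₀ * (4 * n + 4) := by positivity
  by_contra! hcon
  nlinarith [mul_nonneg (show (0 : ℝ) ≤ n + 2 by linarith) hcon]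

theorem exists_admissible_rayleigh_neg (hn : 2 < n) : ∃ v ∈ admissible n, rayleigh v < 0 := by
  obtain ⟨v, hv, hneg⟩ := exists_rayleigh_neg hn
  have h0 : v ≠ 0 := by
    rintro rfl
    have h := lambdaStar_mul_le_rayleigh hn hv
    rw [norm_zero, zero_pow two_ne_zero, mul_zero] at h
    exact hneg.not_ge h
  have hpos : 0 < ‖v‖ := norm_pos_iff.2 h0
  refine ⟨‖v‖⁻¹ • v, ⟨⟨_, (isWeakGradient_weakGrad hv).const_smul _⟩, ?_⟩, ?_⟩
  · rw [norm_smul, norm_inv, norm_norm, inv_mul_cancel₀ hpos.ne']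
  · rw [rayleigh_smul hn hv]
    exact mul_neg_of_pos_of_neg (by positivity) hneg

/-! ### The infimum and its minimizing sequences -/

/-- Real `sInf` takes a default value on empty or unbounded sets; this certifies a genuine finite
infimum. -/
theorem isGLB_lambdaStar (hn : 2 < n) : IsGLB (rayleigh '' admissible n) (lambdaStar n) := by
  obtain ⟨v, hv, -⟩ := exists_admissible_rayleigh_neg hn
  exact isGLB_csInf ⟨_, Set.mem_image_of_mem _ hv⟩ (bddBelow_rayleigh hn)

theorem lambdaStar_neg (hn : 2 < n) : lambdaStar n < 0 := by
  obtain ⟨v, hv, hneg⟩ := exists_admissible_rayleigh_neg hn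
  exact ((isGLB_lambdaStar hn).1 (Set.mem_image_of_mem _ hv)).trans_lt hneg

/-- Minimizing sequences are bounded in `H¹`. -/
theorem IsMinimizingSeq.exists_norm_weakGrad_le (hn : 2 < n) {w : ℕ → L2 n}
    (hw : IsMinimizingSeq w) : ∃ D, ∀ k, ‖weakGrad (w k)‖ ≤ D := by
  obtain ⟨B, hB⟩ := hw.2.bddAbove_range
  refine ⟨Real.sqrt (B + pS n), fun k => Real.le_sqrt_of_sq_le ?_⟩
  have h₁ := rayleigh_eq hn (w k)
  have h₂ := potForm_le hn (w k)
  have h₃ : rayleigh (w k) ≤ B := hB ⟨k, rfl⟩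
  rw [(hw.1 k).2] at h₂
  linarith

theorem IsMinimizingSeq.exists_tendsto_subseq (hn : 2 < n) {w : ℕ → L2 n}
    (hw : IsMinimizingSeq w) :
    ∃ k : ℕ → ℕ, StrictMono k ∧ ∃ w₀ : L2 n, Tendsto (fun j => w (k j)) atTop (𝓝 w₀) := by
  obtain ⟨D, hD⟩ := hw.exists_norm_weakGrad_le hn
  obtain ⟨k, hk, hpot⟩ := exists_subseq_potForm_sub_le hn
    (fun j => isWeakGradient_weakGrad (hw.1 j).1) (fun j => (hw.1 j).2.le) hD
  refine ⟨k, hk, cauchySeq_tendsto_of_complete (Metric.cauchySeq_iff.2 fun ε hε => ?_)⟩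
  have hl := lambdaStar_neg hn
  -- The form contributes less than `4η` and the potential at most `η`; their sum stays below `8η =
  -- |λ₁^*| ε²`.
  let η : ℝ := -lambdaStar n * ε ^ 2 / 8
  have hη : 0 < η := by
    have : 0 < -lambdaStar n := by linarith
    positivity
  obtain ⟨N₁, hN₁⟩ := hpot η hη
  obtain ⟨N₂, hN₂⟩ := eventually_atTop.1
    ((hw.2.comp hk.tendsto_atTop).eventually (gt_mem_nhds (show lambdaStar n < lambdaStar n + η by
      linarith)))
  refine ⟨max N₁ N₂, fun i hi j hj => ?_⟩
  have p := hN₁ i (le_of_max_le_left hi) j (le_of_max_le_left hj)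
  have r₁ : rayleigh (w (k i)) < lambdaStar n + η := hN₂ i (le_of_max_le_right hi)
  have r₂ : rayleigh (w (k j)) < lambdaStar n + η := hN₂ j (le_of_max_le_right hj)
  have h := rayleigh_sub_le hn (hw.1 (k i)).1 (hw.1 (k j)).1
  rw [(hw.1 (k i)).2, (hw.1 (k j)).2, rayleigh_eq hn] at h
  have hsq : -lambdaStar n * ‖w (k i) - w (k j)‖ ^ 2 < -lambdaStar n * ε ^ 2 := by
    have : -lambdaStar n * ε ^ 2 = 8 * η := by simp only [η]; ring
    nlinarith [sq_nonneg ‖weakGrad (w (k i) - w (k j))‖]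
  rw [dist_eq_norm]
  exact lt_of_pow_lt_pow_left₀ 2 hε.le (lt_of_mul_lt_mul_left hsq (by linarith))

end BubbleSpectral

theorem mainTheorem5 (n : ℕ) (hn : 2 < n) :
    (IsGLB (rayleigh '' admissible n) (lambdaStar n) ∧ lambdaStar n < 0) ∧
    (∀ w : ℕ → L2 n, IsMinimizingSeq w →
      ∃ k : ℕ → ℕ, StrictMono k ∧ ∃ w₀ : L2 n, Tendsto (fun j => w (k j)) atTop (𝓝 w₀)) :=
  ⟨⟨isGLB_lambdaStar hn, lambdaStar_neg hn⟩, fun _ hw => hw.exists_tendsto_subseq hn⟩
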